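/- Conventions. All algebras and spaces are over $\mathbb C$, and Banach algebras are considered up to bicontinuous algebra isomorphism. A Banach algebra $A$ is called an operator algebra if it is bicontinuously isomorphic, as an algebra, to a norm-closed subalgebra of $B(H)$ for some Hilbert space $H$. A left Banach $A$-module is a Banach space $X$ with a continuous (not necessarily unital) algebra homomorphism $\theta : A \to B(X)$; it is Hilbertian if $X$ is isomorphic, as a topological vector space, to a Hilbert space. An operator algebra $A$ has the total reduction property (is a TRA) if, for every Hilbertian Banach $A$-module $X$, each closed submodule $V \subseteq X$ has a closed submodule $W \subseteq X$ with $X = V \oplus W$. For a unital commutative Banach algebra $A$, let $\Phi_A$ be its space of characters (equivalently, maximal ideals) with the relative weak-$*$ topology. The hull-kernel topology on $\Phi_A$ is the topology whose closure operation is $E \mapsto \{\omega \in \Phi_A : \omega(a) = 0 \text{ for every } a \in A \text{ that vanishes on } E\}$, where $a$ vanishes on $E$ if $\varphi(a)=0$ for all $\varphi\in E$. $A$ is regular if the hull-kernel topology coincides with the weak-$*$ topology, and semisimple if its Jacobson radical is $\{0\}$. Theorem. Let $A$ be a unital, semisimple and regular commutative operator algebra with the total reduction property. Then $A \cong C(\Phi_A)$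 as Banach algebras. More precisely, the Gelfand transform $\Gamma : A \to C(\Phi_A)$, $\Gamma(a)(\omega) = \omega(a)$, is an algebra isomorphism of $A$ onto $C(\Phi_A)$ which is a homeomorphism for the norm of $A$ and the uniform norm of $C(\Phi_A)$. -/

import Mathlib

universe u

namespace TotalReduction

section OperatorAlgebras

/-- `A` is an operator algebra: there are a complex Hilbert space `H` and a Banach algebra
isomorphism of `A` onto a closed subalgebra of `B(H)`. The isomorphism need not be isometric, and
the unit of `A` (if any) need not be sent to the identity operator. -/
def IsOperatorAlgebra (A : Type u) [NormedRing A] [NormedAlgebra ℂ A] : Prop :=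
  ∃ (H : Type u) (_ : NormedAddCommGroup H) (_ : InnerProductSpace ℂ H) (_ : CompleteSpace H)
    (θ : A →ₙₐ[ℂ] (H →L[ℂ] H)), Topology.IsClosedEmbedding θ

/-- The Banach space `X` is isomorphic (as a topological vector space) to a Hilbert space. -/
def IsHilbertian (X : Type u) [NormedAddCommGroup X] [NormedSpace ℂ X] : Prop :=
  ∃ (H : Type u) (_ : NormedAddCommGroup H) (_ : InnerProductSpace ℂ H) (_ : CompleteSpace H),
    Nonempty (X ≃L[ℂ] H)

/-- `V` is a (closed) submodule of the Banach module given by the representation `θ`. -/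
structure IsClosedSubmodule {A X : Type u} [NormedRing A] [NormedAlgebra ℂ A]
    [NormedAddCommGroup X] [NormedSpace ℂ X] (θ : A →ₙₐ[ℂ] (X →L[ℂ] X))
    (V : Submodule ℂ X) : Prop where
  isClosed : IsClosed (V : Set X)
  apply_mem : ∀ (a : A), ∀ x ∈ V, θ a x ∈ V

/-- The Banach module given by the representation `θ` has the reduction property: each closed
submodule `V` has a closed submodule `W` with `X = V ⊕ W`. -/
def HasReductionProperty {A X : Type u} [NormedRing A] [NormedAlgebra ℂ A]
    [NormedAddCommGroup X] [NormedSpace ℂ X] (θ : A →ₙₐ[ℂ] (X →L[ℂ] X)) : Prop :=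
  ∀ V : Submodule ℂ X, IsClosedSubmodule θ V →
    ∃ W : Submodule ℂ X, IsClosedSubmodule θ W ∧ IsCompl V W

/-- `A` has the total reduction property: every Hilbertian Banach `A`-module has the reduction
property. A left Banach `A`-module structure on `X` is the same thing as a continuous, not
necessarily unital, representation of `A` on `X`. -/
def HasTotalReductionProperty (A : Type u) [NormedRing A] [NormedAlgebra ℂ A] : Prop :=
  ∀ (X : Type u) [NormedAddCommGroup X] [NormedSpace ℂ X] [CompleteSpace X]
    (θ : A →ₙₐ[ℂ] (X →L[ℂ] X)), Continuous θ → IsHilbertian X → HasReductionProperty θ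

/-- A total reduction algebra: an operator algebra with the total reduction property. -/
structure IsTotalReductionAlgebra (A : Type u) [NormedRing A] [NormedAlgebra ℂ A] : Prop where
  isOperatorAlgebra : IsOperatorAlgebra A
  hasTotalReductionProperty : HasTotalReductionProperty A

end OperatorAlgebras

section HullKernel

open WeakDual

variable (A : Type u) [NormedCommRing A] [NormedAlgebra ℂ A]

/-- The ideal `ker E = {a | ω a = 0 for all ω ∈ E}` for a set `E` of characters of `A`. -/
def kernel (E : Set (characterSpace ℂ A)) : Ideal A where
  carrier := {a | ∀ ω ∈ E, ω a = 0}
  add_mem' ha hb ω hω := by rw [map_add, ha ω hω, hb ω hω, add_zero]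
  zero_mem' ω _ := map_zero ω
  smul_mem' c a ha ω hω := by rw [smul_eq_mul, map_mul, ha ω hω, mul_zero]

/-- The hull of an ideal `J`: the set of characters which vanish on `J`. -/
def hull (J : Ideal A) : Set (characterSpace ℂ A) :=
  {ω | ∀ a ∈ J, ω a = 0}

theorem subset_hull_kernel (E : Set (characterSpace ℂ A)) : E ⊆ hull A (kernel A E) :=
  fun ω hω _ ha => ha ω hω

theorem hull_kernel_mono {E F : Set (characterSpace ℂ A)} (h : E ⊆ F) :
    hull A (kernel A E) ⊆ hull A (kernel A F) :=
  fun _ hω a ha => hω a fun φ hφ => ha φ (h hφ)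

theorem hull_kernel_union (E F : Set (characterSpace ℂ A)) :
    hull A (kernel A (E ∪ F)) ⊆ hull A (kernel A E) ∪ hull A (kernel A F) := by
  intro ω hω
  by_contra hcon
  have h1 : ω ∉ hull A (kernel A E) := fun h => hcon (Or.inl h)
  have h2 : ω ∉ hull A (kernel A F) := fun h => hcon (Or.inr h)
  simp only [hull, Set.mem_ofPred_eq, not_forall] at h1 h2
  obtain ⟨a, ha, hωa⟩ := h1
  obtain ⟨b, hb, hωb⟩ := h2
  have hab : ω (a * b) = 0 := by
    refine hω (a * b) ?_
    rintro φ (hφ | hφ)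
    · rw [map_mul, ha φ hφ, zero_mul]
    · rw [map_mul, hb φ hφ, mul_zero]
  rw [map_mul] at hab
  exact (mul_ne_zero hωa hωb) hab

/-- The hull-kernel topology on the character space, whose closed sets are the sets `E` with
`hull (ker E) = E`. -/
@[reducible] def hullKernelTopology : TopologicalSpace (characterSpace ℂ A) :=
  TopologicalSpace.ofClosed {E | hull A (kernel A E) = E}
    (by
      refine Set.Subset.antisymm (fun ω hω => ?_) (Set.empty_subset _)
      have h : ω (1 : A) = 0 := hω 1 fun φ hφ => hφ.elim
      rw [map_one] at h
      exact one_ne_zero h)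
    (by
      intro S hS
      refine Set.Subset.antisymm (fun ω hω E hE => ?_) (subset_hull_kernel A _)
      rw [← hS hE]
      exact hull_kernel_mono A (Set.sInter_subset_of_mem hE) hω)
    (by
      intro E hE F hF
      refine Set.Subset.antisymm (fun ω hω => ?_) (subset_hull_kernel A _)
      have h := hull_kernel_union A E F hω
      rwa [hE, hF] at h)

/-- `A` is regular: the hull-kernel topology on the character space coincides with the weak-*
topology (the instance topology on `characterSpace ℂ A`). -/
def IsRegular : Prop :=
  hullKernelTopology A = (inferInstance : TopologicalSpace (characterSpace ℂ A))

/-- `A` is semisimple: its Jacobson radical is zero. -/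
def IsSemisimple : Prop :=
  Ring.jacobson A = ⊥

end HullKernel

end TotalReduction

/-!
The Gelfand transform is injective by semisimplicity, so by the open mapping theorem it suffices that
it is onto `C(Φ_A)`. This follows as soon as `A` contains Urysohn functions with a common norm bound
for all pairs of disjoint closed subsets of `Φ_A`: means of such functions over the level sets of a
continuous function approximate it uniformly with control of the norm in `A`
(`surjective_of_bounded_urysohn`).

Regularity gives, for disjoint closed sets `E` and `F`, an element `a` equal to `1` on `E` and to `0`
on `F`. Such an `a` is idempotent modulo the ideal `I = kernel (E ∪ F)`, and its coset consists of
such elements, so the question is whether the idempotents of the quotients `A ⧸ I` are uniformly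
bounded in norm. This is where the total reduction property enters
(`IsTotalReductionAlgebra.exists_norm_lift_idempotent_le`). In a module, an element of the
commutative algebra `A` acting as an idempotent is equal to every module projection onto its range,
and module projections can be chosen with a uniform bound, since the reduction property holds for
ℓ²-sums of modules (`exists_bounded_projections`).

To compare the quotient norm of `a` with its action on modules, let `A ⊆ B(H)`. If the coset `a + I`
avoids a large ball, the Hahn–Banach theorem provides a positive functional on `B(H)` whose GNS
vector `ξ` satisfies `‖(a + b) ξ‖ ≥ d ‖ξ‖` for all `b ∈ I`, with `d` large (`exists_gns_norm_le`).
A bounded module projection with kernel the closure of `I ξ` maps `ξ` to a vector annihilated by `I`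
on which `a` is still large, while `a` acts as a bounded idempotent on the annihilator of `I`.
-/

namespace TotalReduction

open WeakDual

/-! ### Separating convex sets of operators from zero by vectors, and uniform projections -/

open scoped ComplexOrder in
/-- A convex set which stays outside a ball of a C⋆-algebra is kept away from zero by a single
vector of a single representation. The functional separating the ball of radius `d ^ 2` from
the set of upper bounds of the elements `c⋆ c` is positive, and `ξ` is the cyclic vector of its GNS
representation; operator convexity of `c ↦ c⋆ c` makes the set of upper bounds convex. -/
theorem exists_gns_norm_le {B : Type u} [CStarAlgebra B] [PartialOrder B] [StarOrderedRing B]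
    {S : Set B} (hS : Convex ℝ S) (hne : S.Nonempty) {d : ℝ} (hd : 0 < d)
    (hdS : ∀ c ∈ S, d ≤ ‖c‖) :
    ∃ (K : Type u) (_ : NormedAddCommGroup K) (_ : InnerProductSpace ℂ K) (_ : CompleteSpace K)
      (π : B →⋆ₐ[ℂ] (K →L[ℂ] K)) (ξ : K), ξ ≠ 0 ∧ ∀ c ∈ S, d * ‖ξ‖ ≤ ‖π c ξ‖ := by
  set D : Set B := {T | ∃ c ∈ S, star c * c ≤ T} with hD
  have hDconv : Convex ℝ D := by
    rintro T ⟨c, hc, hcT⟩ T' ⟨c', hc', hcT'⟩ s t hs ht hst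
    refine ⟨s • c + t • c', hS hc hc' hs ht hst, ?_⟩
    have key : s • (star c * c) + t • (star c' * c') - star (s • c + t • c') * (s • c + t • c')
        = (s * t) • (star (c - c') * (c - c')) := by
      obtain rfl : t = 1 - s := by linarith
      simp only [star_add, star_sub, star_smul, star_trivial, add_mul, mul_add, sub_mul, mul_sub,
        smul_mul_assoc, mul_smul_comm]
      module
    have h0 : 0 ≤ (s * t) • (star (c - c') * (c - c')) :=
      smul_nonneg (mul_nonneg hs ht) (star_mul_self_nonneg _)
    rw [← key, sub_nonneg] at h0
    exact h0.trans (add_le_add (smul_le_smul_of_nonneg_left hcT hs)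
      (smul_le_smul_of_nonneg_left hcT' ht))
  have hdisj : Disjoint (Metric.ball (0 : B) (d ^ 2)) D := by
    rw [Set.disjoint_left]
    rintro T hT ⟨c, hc, hcT⟩
    have h1 : ‖star c * c‖ ≤ ‖T‖ :=
      CStarAlgebra.norm_le_norm_of_nonneg_of_le (star_mul_self_nonneg c) hcT
    rw [CStarRing.norm_star_mul_self] at h1
    rw [mem_ball_zero_iff] at hT
    nlinarith [hdS c hc]
  obtain ⟨f, r, hfr, hrf⟩ := RCLike.geometric_hahn_banach_open (𝕜 := ℂ)
    (convex_ball (0 : B) (d ^ 2)) Metric.isOpen_ball hDconv hdisj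
  have hr : 0 < r := by
    simpa using hfr 0 (Metric.mem_ball_self (by positivity))
  have hpos : ∀ T : B, 0 ≤ T → 0 ≤ (f T).re := by
    intro T hT
    by_contra! hneg
    obtain ⟨c, hc⟩ := hne
    -- a negative value on `T` would be unbounded below on the ray `c⋆ c + ℝ≥0 T ⊆ D`
    set t : ℝ := ((f (star c * c)).re) / (-(f T).re) with ht
    have h1 := hrf (star c * c) ⟨c, hc, le_rfl⟩
    have ht0 : 0 ≤ t := div_nonneg (hr.le.trans h1) (by linarith)
    have h2 := hrf (star c * c + t • T) ⟨c, hc, le_add_of_nonneg_right (smul_nonneg ht0 hT)⟩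
    have h3 : t * (f T).re = -(f (star c * c)).re := by
      rw [ht, div_neg, neg_mul, div_mul_cancel₀ _ hneg.ne]
    rw [map_add, ← Complex.coe_smul, map_smul] at h2
    simp [h3] at h2
    linarith
  -- The separating functional need not be real on self-adjoint elements: it is replaced by its
  -- hermitian part, which agrees there with its real part.
  let φ₀ : B →ₗ[ℂ] ℂ :=
    { toFun := fun T => (2⁻¹ : ℂ) * (f T + star (f (star T)))
      map_add' := fun S T => by simp only [star_add, map_add]; ring
      map_smul' := fun z T => by
        simp only [star_smul, map_smul, smul_eq_mul, star_mul', star_star, RingHom.id_apply]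
        ring }
  have hφ₀ : ∀ T : B, IsSelfAdjoint T → φ₀ T = ((f T).re : ℂ) := by
    intro T hT
    change (2⁻¹ : ℂ) * (f T + star (f (star T))) = _
    rw [hT.star_eq]
    apply Complex.ext <;> simp
    ring
  let φ : B →ₚ[ℂ] ℂ := PositiveLinearMap.mk₀ φ₀ fun T hT => by
    rw [hφ₀ T hT.isSelfAdjoint]
    exact_mod_cast hpos T hT
  have hφ : ∀ T : B, IsSelfAdjoint T → φ T = ((f T).re : ℂ) := hφ₀
  have hnorm : ∀ c : B, ‖φ.gnsStarAlgHom c (φ.toPreGNS 1 : φ.PreGNS)‖ ^ 2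
      = (f (star c * c)).re := by
    intro c
    have h1 : φ.gnsStarAlgHom c (φ.toPreGNS 1 : φ.PreGNS) = ((φ.toPreGNS c : φ.PreGNS) : φ.GNS) := by
      simp [PositiveLinearMap.gnsStarAlgHom]
    have h2 := φ.preGNS_norm_sq (φ.toPreGNS c)
    rw [φ.ofPreGNS_toPreGNS, hφ _ (IsSelfAdjoint.star_mul_self c)] at h2
    rw [h1, UniformSpace.Completion.norm_coe]
    exact_mod_cast h2
  -- The cyclic vector satisfies `‖ξ‖ ^ 2 = φ 1`, so this bounds the norm of `φ` by `r / d ^ 2`.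
  have hξ : ‖((φ.toPreGNS 1 : φ.PreGNS) : φ.GNS)‖ ^ 2 * d ^ 2 ≤ r := by
    have h1 := hnorm 1
    rw [map_one, one_apply_eq_self, star_one, one_mul] at h1
    rw [h1]
    by_contra! hlt
    have hp : 0 < (f 1).re := by
      by_contra! hn
      nlinarith [sq_nonneg d]
    -- test the separating functional on the scalar `r / f 1`, which lies in the ball
    have h2 := hfr ((r / (f 1).re) • 1) (by
      rw [mem_ball_zero_iff]
      have : Nontrivial B := ⟨1, 0, fun h => by simp [h] at hp⟩
      rwa [norm_smul, CStarRing.norm_one, mul_one, Real.norm_of_nonneg (div_nonneg hr.le hp.le),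
        div_lt_iff₀ hp, mul_comm])
    rw [← Complex.coe_smul, map_smul] at h2
    simp at h2
    rw [div_mul_cancel₀ _ hp.ne'] at h2
    exact lt_irrefl _ h2
  refine ⟨φ.GNS, inferInstance, inferInstance, inferInstance, φ.gnsStarAlgHom,
    (φ.toPreGNS 1 : φ.PreGNS), ?_, ?_⟩
  · intro h0
    obtain ⟨c, hc⟩ := hne
    have h1 := hnorm c
    rw [h0, map_zero, norm_zero] at h1
    have := hrf (star c * c) ⟨c, hc, le_rfl⟩
    simp at h1 this
    linarith
  · intro c hc
    refine le_of_sq_le_sq ?_ (norm_nonneg _)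
    rw [hnorm, mul_pow, mul_comm]
    exact hξ.trans (hrf _ ⟨c, hc, le_rfl⟩)

/-- The total reduction property yields module projections with a common norm bound onto the
members of any bounded family of Hilbert modules with closed submodules: the projection onto the
ℓ²-sum of the submodules is compressed to the summands. -/
theorem exists_bounded_projections {A : Type u} [NormedRing A] [NormedAlgebra ℂ A]
    (hA : HasTotalReductionProperty A) {ι : Type} {X : ι → Type u}
    [∀ i, NormedAddCommGroup (X i)] [∀ i, InnerProductSpace ℂ (X i)] [∀ i, CompleteSpace (X i)]
    (ρ : ∀ i, A →ₙₐ[ℂ] (X i →L[ℂ] X i)) {M : ℝ} (hρ : ∀ i a, ‖ρ i a‖ ≤ M * ‖a‖)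
    (V : ∀ i, Submodule ℂ (X i)) (hV : ∀ i, IsClosedSubmodule (ρ i) (V i)) :
    ∃ (q : ∀ i, X i →L[ℂ] X i) (C : ℝ), ∀ i, ‖q i‖ ≤ C ∧ (∀ x, q i x ∈ V i) ∧
      (∀ x ∈ V i, q i x = x) ∧ ∀ a x, q i (ρ i a x) = ρ i a (q i x) := by
  classical
  have hle : ∀ (a : A) (x : lp X 2) (i : ι), ‖ρ i a (x i)‖ ≤ ‖((M * ‖a‖ : ℝ) • x : lp X 2) i‖ := by
    intro a x i
    rw [lp.coeFn_smul, Pi.smul_apply, norm_smul]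
    exact ((ρ i a).le_opNorm _).trans (mul_le_mul_of_nonneg_right
      ((hρ i a).trans (le_abs_self _)) (norm_nonneg _))
  -- `σ` is the ℓ²-sum of the representations `ρ i`.
  let σ₀ : A → lp X 2 → lp X 2 := fun a x =>
    ⟨fun i => ρ i a (x i), (lp.memℓp ((M * ‖a‖ : ℝ) • x)).mono' (hle a x)⟩
  have hσ₀ : ∀ a x i, σ₀ a x i = ρ i a (x i) := fun _ _ _ => rfl
  have hσle : ∀ a x, ‖σ₀ a x‖ ≤ |M| * ‖a‖ * ‖x‖ := by
    intro a x
    refine (lp.norm_mono two_ne_zero (hle a x)).trans ?_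
    rw [norm_smul, norm_mul, norm_norm, Real.norm_eq_abs]
  let σ₁ : A → (lp X 2 →L[ℂ] lp X 2) := fun a => LinearMap.mkContinuous
    { toFun := σ₀ a
      map_add' := fun x y => by ext i; simp [hσ₀]
      map_smul' := fun c x => by ext i; simp [hσ₀] } (|M| * ‖a‖) (hσle a)
  have hσ₁ : ∀ a x i, σ₁ a x i = ρ i a (x i) := fun _ _ _ => rfl
  let σ : A →ₙₐ[ℂ] (lp X 2 →L[ℂ] lp X 2) :=
    { toFun := σ₁
      map_smul' := fun c a => by ext x i; simp [hσ₁]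
      map_zero' := by ext x i; simp [hσ₁]
      map_add' := fun a b => by ext x i; simp [hσ₁]
      map_mul' := fun a b => by ext x i; simp [hσ₁] }
  have hσ : ∀ a x i, σ a x i = ρ i a (x i) := fun _ _ _ => rfl
  have hσcont : Continuous σ :=
    AddMonoidHomClass.continuous_of_bound σ |M| fun a =>
      ContinuousLinearMap.opNorm_le_bound _ (by positivity) (hσle a)
  -- `Vs` is the ℓ²-sum of the submodules `V i`.
  let Vs : Submodule ℂ (lp X 2) :=
    { carrier := {x | ∀ i, x i ∈ V i}
      add_mem' := fun hx hy i => (V i).add_mem (hx i) (hy i)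
      zero_mem' := fun i => (V i).zero_mem
      smul_mem' := fun c x hx i => (V i).smul_mem c (hx i) }
  have happly : ∀ i, Continuous fun x : lp X 2 => x i := fun i =>
    (lp.evalCLM ℂ X 2 i).continuous
  have hVs : IsClosedSubmodule σ Vs := by
    refine ⟨?_, fun a x hx i => (hV i).apply_mem a _ (hx i)⟩
    change IsClosed {x : lp X 2 | ∀ i, x i ∈ V i}
    simp only [Set.ofPred_forall]
    exact isClosed_iInter fun i => (hV i).isClosed.preimage (happly i)
  obtain ⟨W, hW, hVW⟩ := hA (lp X 2) σ hσcont
    ⟨lp X 2, inferInstance, inferInstance, inferInstance, ⟨ContinuousLinearEquiv.refl ℂ _⟩⟩ Vs hVs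
  have htop := Submodule.IsCompl.isTopCompl_of_isClosed hVW hVs.isClosed hW.isClosed
  set P := Vs.projectionL W htop with hP
  have hPmem : ∀ x, P x ∈ Vs := Submodule.projectionL_apply_mem htop
  have hPid : ∀ x ∈ Vs, P x = x := fun x hx => Submodule.projectionL_apply_left htop ⟨x, hx⟩
  have hPker : ∀ x, P x = 0 ↔ x ∈ W := fun x => Submodule.projectionL_apply_eq_zero_iff htop
  have hPcomm : ∀ a x, P (σ a x) = σ a (P x) := by
    intro a x
    have h1 : x - P x ∈ W := (hPker _).1 (by rw [map_sub, hPid _ (hPmem x), sub_self])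
    have h2 := (hPker _).2 (hW.apply_mem a _ h1)
    rwa [map_sub, map_sub, hPid _ (hVs.apply_mem a _ (hPmem x)), sub_eq_zero] at h2
  have hsingle : ∀ a i (x : X i), σ a (lp.single 2 i x) = lp.single 2 i (ρ i a x) := by
    intro a i x
    ext j
    rw [hσ]
    obtain rfl | hij := eq_or_ne j i
    · simp
    · simp [hij]
  refine ⟨fun i => lp.evalCLM ℂ X 2 i ∘L P ∘L lp.singleContinuousLinearMap ℂ X 2 i, ‖P‖,
    fun i => ⟨?_, fun x => hPmem _ i, fun x hx => ?_, fun a x => ?_⟩⟩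
  · refine ContinuousLinearMap.opNorm_le_bound _ (norm_nonneg _) fun x => ?_
    refine (lp.norm_apply_le_norm two_ne_zero (P (lp.single 2 i x)) i).trans ?_
    refine (P.le_opNorm _).trans_eq ?_
    rw [lp.norm_single (by norm_num)]
  · have h1 : lp.single 2 i x ∈ Vs := by
      intro j
      obtain rfl | hij := eq_or_ne j i
      · simpa using hx
      · simp [hij]
    change P (lp.single 2 i x) i = x
    rw [hPid _ h1, lp.single_apply_self]
  · change P (lp.single 2 i (ρ i a x)) i = ρ i a (P (lp.single 2 i x) i)
    rw [← hsingle, hPcomm, hσ]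

/-! ### Idempotents in quotients -/

/-- The idempotents of all the quotients `A ⧸ I` of a commutative total reduction algebra have a
common norm bound. The ideal `I` need not be closed.

If the bound failed along a sequence, then `exists_gns_norm_le`, applied to the cosets `a + I`,
would give modules with vectors `ξ` for which `a ξ` is far from `I ξ`. After a bounded module
projection `ξ` is annihilated by `I`; on the annihilator of `I` the element `a` acts as an
idempotent, which by commutativity coincides with any module projection onto its range and is
therefore bounded. -/
theorem IsTotalReductionAlgebra.exists_norm_lift_idempotent_le {A : Type u} [NormedCommRing A]
    [NormedAlgebra ℂ A] (hA : IsTotalReductionAlgebra A) :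
    ∃ K : ℝ, ∀ (I : Ideal A) (a : A), a * a - a ∈ I → ∃ b ∈ I, ‖a + b‖ ≤ K := by
  by_contra! hcon
  obtain ⟨H, _, _, _, θ, hθ⟩ := hA.isOperatorAlgebra
  let θL : A →L[ℂ] (H →L[ℂ] H) := ⟨(θ : A →ₗ[ℂ] (H →L[ℂ] H)), hθ.continuous⟩
  obtain ⟨κ, hκ⟩ := θL.antilipschitz_of_isEmbedding hθ.isEmbedding
  have hκ' : ∀ x, ‖x‖ ≤ (κ + 1) * ‖θ x‖ := fun x =>
    (ZeroHomClass.bound_of_antilipschitz θL hκ x).trans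
      (mul_le_mul_of_nonneg_right (by simp) (norm_nonneg _))
  -- The constant `κ + 1` is used instead of `κ` so that one may divide by it.
  have hκ0 : (0 : ℝ) < κ + 1 := by positivity
  choose I a haI hlarge using fun n : ℕ => hcon (n + 1)
  have hconv : ∀ n, Convex ℝ (θL '' ((a n + ·) '' (I n : Set A))) := fun n =>
    (((I n).restrictScalars ℝ).convex.translate (a n)).linear_image
      ((θL : A →ₗ[ℂ] (H →L[ℂ] H)).restrictScalars ℝ)
  have hgns := fun n : ℕ => exists_gns_norm_le
    (hconv n) (((I n).nonempty.image _).image _)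
    (d := (n + 1) / (κ + 1)) (by positivity)
    (by
      rintro _ ⟨_, ⟨b, hb, rfl⟩, rfl⟩
      rw [div_le_iff₀ hκ0, mul_comm]
      exact (hlarge n b hb).le.trans (hκ' _))
  choose X i₁ i₂ i₃ π ξ hξ hle using hgns
  have hle' : ∀ n, ∀ b ∈ I n, (n + 1) / (κ + 1) * ‖ξ n‖ ≤ ‖π n (θ (a n + b)) (ξ n)‖ :=
    fun n b hb => hle n _ ⟨_, ⟨b, hb, rfl⟩, rfl⟩
  let ρ : ∀ n, A →ₙₐ[ℂ] (X n →L[ℂ] X n) := fun n =>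
    { toFun := fun x => π n (θ x)
      map_smul' := fun c x => by simp
      map_zero' := by simp
      map_add' := fun x y => by simp
      map_mul' := fun x y => by simp }
  have hρle : ∀ n x, ‖ρ n x‖ ≤ ‖θL‖ * ‖x‖ := fun n x =>
    (NonUnitalStarAlgHom.norm_apply_le (π n) (θ x)).trans (θL.le_opNorm x)
  have hρmul : ∀ n x y v, ρ n (x * y) v = ρ n x (ρ n y v) := fun n x y v => by
    rw [map_mul, mul_apply_eq_comp]
  have hρcomm : ∀ n x y v, ρ n x (ρ n y v) = ρ n y (ρ n x v) := fun n x y v => by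
    rw [← hρmul, mul_comm, hρmul]
  -- the component of `ξ n` in a complement of the closure of `I n • ξ n` is annihilated by `I n`
  let orb : ∀ n, A →ₗ[ℂ] X n := fun n =>
    { toFun := fun x => ρ n x (ξ n)
      map_add' := fun x y => by simp
      map_smul' := fun c x => by simp }
  let N : ∀ n, Submodule ℂ (X n) := fun n =>
    (((I n).restrictScalars ℂ).map (orb n)).topologicalClosure
  have hN : ∀ n, IsClosedSubmodule (ρ n) (N n) := by
    refine fun n => ⟨Submodule.isClosed_topologicalClosure _, fun x v hv => ?_⟩
    refine map_mem_closure (ρ n x).continuous hv ?_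
    rintro _ ⟨b, hb, rfl⟩
    exact ⟨x * b, (I n).mul_mem_left x hb, hρmul n x b (ξ n)⟩
  obtain ⟨q, C, hq⟩ := exists_bounded_projections hA.hasTotalReductionProperty ρ hρle N hN
  have hmemN : ∀ n, ∀ b ∈ I n, ρ n b (ξ n) ∈ N n := fun n b hb =>
    Submodule.le_topologicalClosure _ ⟨b, hb, rfl⟩
  let y : ∀ n, X n := fun n => ξ n - q n (ξ n)
  have hρy : ∀ n x, ρ n x (y n) = ρ n x (ξ n) - q n (ρ n x (ξ n)) := fun n x => by
    rw [(hq n).2.2.2, map_sub]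
  have hIy : ∀ n, ∀ b ∈ I n, ρ n b (y n) = 0 := fun n b hb => by
    rw [hρy, (hq n).2.2.1 _ (hmemN n b hb), sub_self]
  have hynorm : ∀ n, ‖y n‖ ≤ (1 + C) * ‖ξ n‖ := fun n => by
    refine (norm_sub_le _ _).trans ?_
    rw [add_mul, one_mul]
    gcongr
    exact (q n).le_of_opNorm_le (hq n).1 _
  have hay : ∀ n, (n + 1) / (κ + 1) * ‖ξ n‖ ≤ ‖ρ n (a n) (y n)‖ := by
    intro n
    rw [hρy]
    have hcl : IsClosed {v : X n | (n + 1) / (κ + 1) * ‖ξ n‖ ≤ ‖ρ n (a n) (ξ n) - v‖} :=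
      isClosed_le continuous_const (by fun_prop)
    refine closure_minimal ?_ hcl ((hq n).2.1 (ρ n (a n) (ξ n)))
    rintro _ ⟨b, hb, rfl⟩
    have := hle' n (-b) ((I n).neg_mem hb)
    change _ ≤ ‖ρ n (a n + -b) (ξ n)‖ at this
    rwa [map_add, map_neg, ← sub_eq_add_neg] at this
  -- `a n` acts on the annihilator of `I n` as the projection onto the following submodule
  let V : ∀ n, Submodule ℂ (X n) := fun n =>
    { carrier := {v | (∀ b ∈ I n, ρ n b v = 0) ∧ ρ n (a n) v = v}
      add_mem' := fun {v w} hv hw =>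
        ⟨fun b hb => by rw [map_add, hv.1 b hb, hw.1 b hb, add_zero], by
          rw [map_add, hv.2, hw.2]⟩
      zero_mem' := ⟨fun b _ => map_zero _, map_zero _⟩
      smul_mem' := fun c v hv =>
        ⟨fun b hb => by rw [map_smul, hv.1 b hb, smul_zero], by rw [map_smul, hv.2]⟩ }
  have hV : ∀ n, IsClosedSubmodule (ρ n) (V n) := by
    refine fun n => ⟨?_, fun x v hv => ⟨fun b hb => ?_, ?_⟩⟩
    · change IsClosed {v | (∀ b ∈ I n, ρ n b v = 0) ∧ ρ n (a n) v = v}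
      simp only [Set.ofPred_and, Set.ofPred_forall]
      refine IsClosed.inter (isClosed_iInter fun b => isClosed_iInter fun _ => ?_) ?_
      · exact isClosed_eq (ρ n b).continuous continuous_const
      · exact isClosed_eq (ρ n (a n)).continuous continuous_id
    · rw [hρcomm, hv.1 b hb, map_zero]
    · rw [hρcomm, hv.2]
  obtain ⟨p, C', hp⟩ := exists_bounded_projections hA.hasTotalReductionProperty ρ hρle V hV
  have hpy : ∀ n, ρ n (a n) (y n) = p n (y n) := by
    intro n
    have h1 : ρ n (a n) (y n) ∈ V n := by
      refine ⟨fun b hb => by rw [hρcomm, hIy n b hb, map_zero], ?_⟩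
      have h2 := hIy n _ (haI n)
      rwa [map_sub (ρ n), sub_apply, hρmul, sub_eq_zero] at h2
    rw [← (hp n).2.2.1 _ h1, (hp n).2.2.2, ((hp n).2.1 (y n)).2]
  have hbound : ∀ n : ℕ, ((n : ℝ) + 1) / (κ + 1) ≤ C' * (1 + C) := by
    intro n
    have hC' : 0 ≤ C' := (norm_nonneg _).trans (hp n).1
    refine le_of_mul_le_mul_right ?_ (norm_pos_iff.2 (hξ n))
    calc ((n : ℝ) + 1) / (κ + 1) * ‖ξ n‖ ≤ ‖p n (y n)‖ := hpy n ▸ hay n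
      _ ≤ C' * ‖y n‖ := (p n).le_of_opNorm_le (hp n).1 _
      _ ≤ C' * ((1 + C) * ‖ξ n‖) := by gcongr; exact hynorm n
      _ = C' * (1 + C) * ‖ξ n‖ := by ring
  obtain ⟨n, hn⟩ := exists_nat_gt (C' * (1 + C) * (κ + 1))
  have := (div_le_iff₀ hκ0).1 (hbound n)
  linarith

/-! ### Bounded Urysohn functions on the character space -/

theorem IsRegular.hull_kernel_eq {A : Type u} [NormedCommRing A] [NormedAlgebra ℂ A]
    (hreg : IsRegular A) {E : Set (characterSpace ℂ A)}
    (hE : IsClosed E) : hull A (kernel A E) = E := by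
  have h : @IsClosed _ (hullKernelTopology A) E := by rw [hreg]; exact hE
  rw [← @isOpen_compl_iff _ _ (hullKernelTopology A)] at h
  have h' : Eᶜᶜ ∈ {E | hull A (kernel A E) = E} := h
  rwa [compl_compl] at h'

/-- A regular algebra is normal: no character vanishes on `kernel E + kernel F` when `E` and `F` are
disjoint and closed, so that this ideal contains `1`. -/
theorem IsRegular.exists_eq_one_eq_zero {A : Type u} [NormedCommRing A] [NormedAlgebra ℂ A]
    [CompleteSpace A]
    (hreg : IsRegular A) {E F : Set (characterSpace ℂ A)}
    (hE : IsClosed E) (hF : IsClosed F) (hEF : Disjoint E F) :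
    ∃ a : A, (∀ ω ∈ E, ω a = 1) ∧ ∀ ω ∈ F, ω a = 0 := by
  have htop : kernel A E ⊔ kernel A F = ⊤ := by
    by_contra hne
    obtain ⟨J, hJ, hle⟩ := Ideal.exists_le_maximal _ hne
    have hω : ∀ a ∈ kernel A E ⊔ kernel A F, J.toCharacterSpace a = 0 := fun a ha =>
      J.toCharacterSpace_apply_eq_zero_of_mem (hle ha)
    refine (Set.disjoint_left.1 hEF : ∀ ⦃ω⦄, ω ∈ E → ω ∉ F)
      (?_ : J.toCharacterSpace ∈ E) ?_
    · rw [← hreg.hull_kernel_eq hE]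
      exact fun a ha => hω a (Ideal.mem_sup_left ha)
    · rw [← hreg.hull_kernel_eq hF]
      exact fun a ha => hω a (Ideal.mem_sup_right ha)
  obtain ⟨u, hu, v, hv, huv⟩ := Submodule.mem_sup.1 ((Ideal.eq_top_iff_one _).1 htop)
  refine ⟨v, fun ω hω => ?_, hv⟩
  rw [← map_one ω, ← huv, map_add, hu ω hω, zero_add]

/-- Urysohn functions for disjoint closed sets of characters can be chosen in `A` with a common
norm bound, because an element with values `1` on `E` and `0` on `F` is idempotent modulo
`kernel (E ∪ F)`. -/
theorem exists_bounded_eq_one_eq_zero {A : Type u} [NormedCommRing A] [NormedAlgebra ℂ A]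
    [CompleteSpace A]
    (hA : IsTotalReductionAlgebra A) (hreg : IsRegular A) :
    ∃ K : ℝ, ∀ E F : Set (characterSpace ℂ A), IsClosed E → IsClosed F → Disjoint E F →
      ∃ a : A, ‖a‖ ≤ K ∧ (∀ ω ∈ E, ω a = 1) ∧ ∀ ω ∈ F, ω a = 0 := by
  obtain ⟨K, hK⟩ := hA.exists_norm_lift_idempotent_le
  refine ⟨K, fun E F hE hF hEF => ?_⟩
  obtain ⟨a, ha1, ha0⟩ := hreg.exists_eq_one_eq_zero hE hF hEF
  obtain ⟨b, hb, hab⟩ := hK (kernel A (E ∪ F)) a (by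
    rintro ω (hω | hω)
    · simp [ha1 ω hω]
    · simp [ha0 ω hω])
  refine ⟨a + b, hab, fun ω hω => ?_, fun ω hω => ?_⟩
  · rw [map_add, ha1 ω hω, hb ω (Or.inl hω), add_zero]
  · rw [map_add, ha0 ω hω, hb ω (Or.inr hω), add_zero]

/-- The factor `‖1‖` is present because the norm of `A` is not assumed to satisfy `‖1‖ = 1`. -/
theorem norm_character_apply_le {A : Type u} [NormedCommRing A] [NormedAlgebra ℂ A]
    [CompleteSpace A]
    (ω : characterSpace ℂ A) (a : A) : ‖ω a‖ ≤ ‖(1 : A)‖ * ‖a‖ := by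
  rw [mul_comm]
  exact spectrum.norm_le_norm_mul_of_mem (CharacterSpace.apply_mem_spectrum ω a)

theorem IsSemisimple.gelfandTransform_injective {A : Type u} [NormedCommRing A] [NormedAlgebra ℂ A]
    [CompleteSpace A]
    (hss : IsSemisimple A) :
    Function.Injective (gelfandTransform ℂ A) := by
  rw [injective_iff_map_eq_zero]
  intro a ha
  have h : a ∈ Ring.jacobson A := by
    rw [← Ideal.jacobson_bot, Ideal.mem_jacobson_bot]
    intro b
    by_contra hb
    obtain ⟨ω, hω⟩ := CharacterSpace.exists_apply_eq_zero hb
    have h0 : ω a = 0 := congrArg (fun f => f ω) ha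
    simp [h0] at hω
  rwa [hss, Submodule.mem_bot] at h

/-! ### Surjectivity onto spaces of continuous functions -/

/-- The successive approximation step of the open mapping theorem. -/
theorem surjective_of_exists_norm_sub_le_half {𝕜 E F : Type*} [NontriviallyNormedField 𝕜]
    [NormedAddCommGroup E] [NormedSpace 𝕜 E] [CompleteSpace E] [NormedAddCommGroup F]
    [NormedSpace 𝕜 F] (T : E →L[𝕜] F) {C : ℝ}
    (hT : ∀ y, ∃ x, ‖x‖ ≤ C * ‖y‖ ∧ ‖y - T x‖ ≤ ‖y‖ / 2) : Function.Surjective T := by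
  intro y
  choose g hgC hg using hT
  -- `r n` is the remainder after `n` corrections.
  let r : ℕ → F := fun n => (fun z => z - T (g z))^[n] y
  have hr : ∀ n, r (n + 1) = r n - T (g (r n)) := fun n => Function.iterate_succ_apply' _ _ _
  have hC : ∀ n, ‖g (r n)‖ ≤ |C| * ‖r n‖ := fun n =>
    (hgC _).trans (mul_le_mul_of_nonneg_right (le_abs_self C) (norm_nonneg _))
  have hrn : ∀ n, ‖r n‖ ≤ ‖y‖ * (1 / 2) ^ n := by
    intro n
    induction n with
    | zero => simp [r]
    | succ n ih =>
      rw [hr, pow_succ]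
      linarith [hg (r n)]
  have hsum : Summable fun n => g (r n) := by
    refine Summable.of_norm_bounded (g := fun n => |C| * (‖y‖ * (1 / 2) ^ n)) ?_ fun n => ?_
    · exact (summable_geometric_two.mul_left _).mul_left _
    · exact (hC n).trans (mul_le_mul_of_nonneg_left (hrn n) (abs_nonneg C))
  refine ⟨∑' n, g (r n), ?_⟩
  have hpart : ∀ n, T (∑ k ∈ Finset.range n, g (r k)) = y - r n := by
    intro n
    induction n with
    | zero => simp [r]
    | succ n ih => rw [Finset.sum_range_succ, map_add, ih, hr]; abel
  have h0 : Filter.Tendsto r Filter.atTop (nhds 0) := by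
    refine squeeze_zero_norm hrn ?_
    simpa using (tendsto_pow_atTop_nhds_zero_of_lt_one (r := (1 / 2 : ℝ)) (by norm_num)
      (by norm_num)).const_mul ‖y‖
  refine tendsto_nhds_unique ((T.continuous.tendsto _).comp hsum.hasSum.tendsto_sum_nat) ?_
  have : (T ∘ fun n => ∑ k ∈ Finset.range n, g (r k)) = fun n => y - r n := funext hpart
  rw [this]
  simpa using h0.const_sub y

/-- Staircase decomposition of a number `t ≥ 0` into the parts of `[0, t]` that lie in the unit
intervals `[j, j + 1]`. -/
theorem sum_range_clamp {t : ℝ} (ht : 0 ≤ t) (n : ℕ) :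
    ∑ j ∈ Finset.range n, max 0 (min 1 (t - j)) = min t n := by
  induction n with
  | zero => simp [ht]
  | succ n ih =>
    rw [Finset.sum_range_succ, ih]
    push_cast
    rcases le_total t n with h | h
    · have h1 : max 0 (min 1 (t - n)) = 0 :=
        max_eq_left ((min_le_right _ _).trans (by linarith))
      rw [h1, min_eq_left h, min_eq_left (h.trans (by linarith)), add_zero]
    · rw [min_eq_right h, max_eq_right (le_min zero_le_one (by linarith)), ← min_add_add_left]
      rw [min_comm]; congr 1; ring

/-- A function `f` with values in `[0, 1]` is close to the mean of `N` Urysohn functions for the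
sets `{f ≥ (j + 1) / N}` and `{f ≤ j / N}`. The mean obeys the norm bound of its terms, and at each
point at most one term differs from the staircase decomposition of `N f`, so that the error is at
most `(‖T‖ K + 1) / N`, although the Urysohn functions need not take values in `[0, 1]`. -/
theorem exists_norm_le_approx_of_mem_Icc
    {X E : Type*} [TopologicalSpace X] [CompactSpace X]
      [NormedAddCommGroup E]
    [NormedSpace ℂ E] (T : E →L[ℂ] C(X, ℂ)) {K : ℝ}
    (hT : ∀ P Q : Set X, IsClosed P → IsClosed Q → Disjoint P Q →
      ∃ a : E, ‖a‖ ≤ K ∧ (∀ x ∈ P, T a x = 1) ∧ ∀ x ∈ Q, T a x = 0)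
    (f : C(X, ℝ)) (hf : ∀ x, f x ∈ Set.Icc (0 : ℝ) 1)
    {ε : ℝ} (hε : 0 < ε) : ∃ a : E, ‖a‖ ≤ K ∧ ∀ x, ‖T a x - f x‖ ≤ ε := by
  obtain ⟨N, hN⟩ := exists_nat_gt ((‖T‖ * K + 1) / ε)
  have hK : 0 ≤ K := by
    obtain ⟨a, ha, -⟩ := hT ∅ ∅ isClosed_empty isClosed_empty (Set.disjoint_empty _)
    exact (norm_nonneg a).trans ha
  have hN0 : (0 : ℝ) < N := lt_of_le_of_lt (by positivity) hN
  choose a haK ha1 ha0 using fun j : ℕ => hT {x | (j : ℝ) + 1 ≤ N * f x} {x | N * f x ≤ j}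
    (isClosed_le (by fun_prop) (by fun_prop)) (isClosed_le (by fun_prop) (by fun_prop))
    (Set.disjoint_left.2 fun x (h1 : (j : ℝ) + 1 ≤ N * f x) (h2 : N * f x ≤ j) => by linarith)
  refine ⟨(N : ℂ)⁻¹ • ∑ j ∈ Finset.range N, a j, ?_, fun x => ?_⟩
  · rw [norm_smul, norm_inv, Complex.norm_natCast, inv_mul_le_iff₀ hN0]
    refine (norm_sum_le_of_le _ fun j _ => haK j).trans_eq ?_
    simp
  · have hsum := sum_range_clamp (mul_nonneg hN0.le (hf x).1) N
    rw [min_eq_left (by nlinarith [(hf x).2])] at hsum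
    have hterm : ∀ j ∈ Finset.range N, ‖T (a j) x - (max 0 (min 1 (N * f x - j)) : ℝ)‖ ≤
        if j = ⌊N * f x⌋₊ then ‖T‖ * K + 1 else 0 := by
      intro j _
      split_ifs with hj
      · refine (norm_sub_le _ _).trans (add_le_add ?_ ?_)
        · exact ((T (a j)).norm_coe_le_norm x).trans (T.le_opNorm_of_le (haK j))
        · rw [Complex.norm_real, Real.norm_of_nonneg (le_max_left _ _)]
          exact max_le zero_le_one (min_le_left _ _)
      · rcases le_or_gt ((j : ℝ) + 1) (N * f x) with h | h
        · rw [ha1 j x h, min_eq_left (by linarith), max_eq_right zero_le_one]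
          simp
        · have h' : N * f x ≤ j := by
            by_contra! hlt
            exact hj ((Nat.floor_eq_iff (mul_nonneg hN0.le (hf x).1)).2 ⟨hlt.le, h⟩).symm
          rw [ha0 j x h', max_eq_left ((min_le_right _ _).trans (by linarith))]
          simp
    have hle : ‖∑ j ∈ Finset.range N, (T (a j) x - (max 0 (min 1 (N * f x - j)) : ℝ))‖
        ≤ ‖T‖ * K + 1 := by
      refine (norm_sum_le_of_le _ hterm).trans ?_
      rw [Finset.sum_ite_eq']
      split_ifs
      · exact le_rfl
      · positivity
    rw [Finset.sum_sub_distrib, ← Complex.ofReal_sum, hsum] at hle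
    have hN0' : (N : ℂ) ≠ 0 := by exact_mod_cast hN0.ne'
    have hval : T ((N : ℂ)⁻¹ • ∑ j ∈ Finset.range N, a j) x - f x
        = (N : ℂ)⁻¹ * (∑ j ∈ Finset.range N, T (a j) x - ((N * f x : ℝ) : ℂ)) := by
      rw [map_smul, map_sum, ContinuousMap.smul_apply, ContinuousMap.sum_apply, smul_eq_mul]
      push_cast
      field_simp
    rw [hval, norm_mul, norm_inv, Complex.norm_natCast, inv_mul_le_iff₀ hN0]
    rw [div_lt_iff₀ hε] at hN
    linarith

/-- A bounded operator from a Banach space into `C(X)` is surjective if its range contains Urysohn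
functions for all pairs of disjoint closed sets, with preimages of bounded norm. -/
theorem surjective_of_bounded_urysohn
    {X E : Type*} [TopologicalSpace X] [CompactSpace X]
      [NormedAddCommGroup E]
    [NormedSpace ℂ E] [CompleteSpace E] (T : E →L[ℂ] C(X, ℂ)) {K : ℝ}
    (hT : ∀ P Q : Set X, IsClosed P → IsClosed Q → Disjoint P Q →
      ∃ a : E, ‖a‖ ≤ K ∧ (∀ x ∈ P, T a x = 1) ∧ ∀ x ∈ Q, T a x = 0) :
    Function.Surjective T := by
  refine surjective_of_exists_norm_sub_le_half T (C := 6 * K) fun g => ?_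
  obtain rfl | hg := eq_or_ne g 0
  · exact ⟨0, by simp⟩
  have hg0 : 0 < ‖g‖ := norm_pos_iff.2 hg
  obtain ⟨u, huK, hu, -⟩ := hT Set.univ ∅ isClosed_univ isClosed_empty (Set.disjoint_empty _)
  have hmem : ∀ s : ℝ, |s| ≤ ‖g‖ → (1 + s / ‖g‖) / 2 ∈ Set.Icc (0 : ℝ) 1 := by
    intro s hs
    have h1 : |s / ‖g‖| ≤ 1 := by
      rw [abs_div, abs_norm]
      exact div_le_one_of_le₀ hs hg0.le
    rw [abs_le] at h1
    constructor <;> linarith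
  -- The real and imaginary parts of `g / ‖g‖` have values in `[-1, 1]`, and are moved into `[0, 1]`
  -- by the map `s ↦ (1 + s) / 2`; the constant `1` is the image of `u`.
  obtain ⟨a, haK, ha⟩ := exists_norm_le_approx_of_mem_Icc T hT
    ⟨fun x => (1 + (g x).re / ‖g‖) / 2, by fun_prop⟩
    (fun x => hmem _ ((Complex.abs_re_le_norm _).trans (g.norm_coe_le_norm x)))
    (ε := 1 / 8) (by norm_num)
  obtain ⟨b, hbK, hb⟩ := exists_norm_le_approx_of_mem_Icc T hT
    ⟨fun x => (1 + (g x).im / ‖g‖) / 2, by fun_prop⟩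
    (fun x => hmem _ ((Complex.abs_im_le_norm _).trans (g.norm_coe_le_norm x)))
    (ε := 1 / 8) (by norm_num)
  refine ⟨(‖g‖ : ℂ) • ((2 : ℂ) • a - u + Complex.I • ((2 : ℂ) • b - u)), ?_, ?_⟩
  · have h : ∀ c : E, ‖c‖ ≤ K → ‖(2 : ℂ) • c - u‖ ≤ 3 * K := fun c hc => by
      refine (norm_sub_le _ _).trans ?_
      rw [norm_smul, Complex.norm_ofNat]
      linarith
    rw [norm_smul, Complex.norm_real, norm_norm, mul_comm]
    refine mul_le_mul_of_nonneg_right ((norm_add_le _ _).trans ?_) hg0.le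
    rw [norm_smul, Complex.norm_I, one_mul]
    linarith [h a haK, h b hbK]
  · rw [ContinuousMap.norm_le _ (by positivity)]
    intro x
    have hgne : (‖g‖ : ℂ) ≠ 0 := by exact_mod_cast hg0.ne'
    have hval : (g - T ((‖g‖ : ℂ) • ((2 : ℂ) • a - u + Complex.I • ((2 : ℂ) • b - u)))) x
        = -(‖g‖ : ℂ) * (2 * (T a x - (((1 + (g x).re / ‖g‖) / 2 : ℝ) : ℂ))
          + 2 * Complex.I * (T b x - (((1 + (g x).im / ‖g‖) / 2 : ℝ) : ℂ))) := by
      simp only [map_smul, map_add, map_sub, ContinuousMap.sub_apply, ContinuousMap.smul_apply,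
        ContinuousMap.add_apply, smul_eq_mul, hu x (Set.mem_univ x)]
      conv_lhs => rw [← Complex.re_add_im (g x)]
      push_cast
      field_simp
      ring
    rw [hval, norm_mul, norm_neg, Complex.norm_real, norm_norm]
    have h1 := ha x
    have h2 := hb x
    simp only [ContinuousMap.coe_mk] at h1 h2
    have h3 : ‖2 * (T a x - (((1 + (g x).re / ‖g‖) / 2 : ℝ) : ℂ))
          + 2 * Complex.I * (T b x - (((1 + (g x).im / ‖g‖) / 2 : ℝ) : ℂ))‖ ≤ 1 / 2 := by
      refine (norm_add_le _ _).trans ?_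
      simp only [norm_mul, Complex.norm_ofNat, Complex.norm_I, mul_one]
      linarith
    nlinarith

end TotalReduction

theorem mainTheorem8 (A : Type u) [NormedCommRing A] [NormedAlgebra ℂ A] [CompleteSpace A]
    (hTRA : TotalReduction.IsTotalReductionAlgebra A)
    (hss : TotalReduction.IsSemisimple A)
    (hreg : TotalReduction.IsRegular A) :
    ∃ e : A ≃A[ℂ] C(WeakDual.characterSpace ℂ A, ℂ),
      ∀ a : A, e a = WeakDual.gelfandTransform ℂ A a := by
  obtain ⟨K, hK⟩ := TotalReduction.exists_bounded_eq_one_eq_zero hTRA hreg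
  let Γ : A →L[ℂ] C(WeakDual.characterSpace ℂ A, ℂ) :=
    (WeakDual.gelfandTransform ℂ A).toLinearMap.mkContinuous ‖(1 : A)‖ fun a =>
      (ContinuousMap.norm_le _ (by positivity)).2 fun ω =>
        TotalReduction.norm_character_apply_le ω a
  have hsurj : Function.Surjective Γ := TotalReduction.surjective_of_bounded_urysohn Γ hK
  let e := AlgEquiv.ofBijective (WeakDual.gelfandTransform ℂ A)
    ⟨hss.gelfandTransform_injective, hsurj⟩
  exact ⟨{ e with
    continuous_toFun := Γ.continuous
    continuous_invFun := e.toEquiv.continuous_symm_iff.2 (Γ.isOpenMap hsurj) }, fun a => rfl⟩
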